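/- A $d$-layer network $G=\ell_d\circ\dots\circ\ell_1:\mathbb{R}^k\to\mathbb{R}^n$ has layers $\ell_j(x)=\sigma_j(W_jx+b_j)$ with matrices $W_j$ and activations $\sigma_j:\mathbb{R}\to\mathbb{R}$ applied coordinatewise; the hidden widths are arbitrary. Norms are Euclidean, and operator norms for matrices. Let $Z\subseteq\mathbb{R}^k$ be the set of admissible latent vectors (possibly $Z=\mathbb{R}^k$) and $S=G(Z)$ the range of the generator. For an $m\times n$ matrix $A$, $x^*\in S$, $y=Ax^*$ and $F(x)=\|y-Ax\|^2$, a PGD sequence with step size $\eta$ is any sequence with $x_0=0$, $w_t=x_t+\eta A^{T}(y-Ax_t)$ and $x_{t+1}=G(z_{t+1})$, $z_{t+1}\in\arg\min_{z\in Z}\|w_t-G(z)\|$. **Theorem.** For every $\gamma$ with $\tfrac23<\gamma<1$ there are constants $c,\kappa>0$ and, for every $\eta$ with $\frac1{2\gamma}<\eta<\frac1\gamma$, a number $\alpha=\alpha(\eta)\in(0,1)$, all depending only on $\gamma$ (and $\alpha$ also on $\eta$), such that for every integer $B\ge0$ there is $C>0$, depending only on $\gamma$ and $B$, with the following property. Let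 $d,k\ge1$, $n\ge2$, $m\ge C\,kd\log n$, let $\delta\ge n^{-Bd}$, and let $G:\mathbb{R}^k\to\mathbb{R}^n$ be a differentiable $d$-layer network all of whose weight matrices have operator norm at most $n^B$ and all of whose activations are $n^B$-Lipschitz. Suppose that every $z\in Z$ admits $z'\in\mathbb{R}^k$ with $\|z'\|\le n^{Bd}$ and $\|G(z)-G(z')\|\le\kappa\sqrt{\delta/n}$ (for example: $\|z\|\le n^{Bd}$ for all $z\in Z$; also, if $G$ has bounded range, $Z=\mathbb{R}^k$ is allowed as soon as $B$ is large enough in terms of $G$ and $\delta$). Let $A$ be a random $m\times n$ matrix with independent $N(0,1/m)$ entries. Then, outside an event of probability at most $e^{-cm}$: 1. $\|A(x_1-x_2)\|^2\ge\gamma\|x_1-x_2\|^2-\delta$ for all $x_1,x_2\in S$; 2. for every $x^*\in S$, every $\eta$ with $\frac1{2\gamma}<\eta<\frac1\gamma$ and every PGD sequence $(x_t)$ with step size $\eta$, one has for all $t\ge0$ $$F(x_{t+1})\le\alpha F(x_t)+\delta,\qquad F(x_t)\le\alpha^tF(x_0)+\frac{\delta}{1-\alpha},$$ and $\gamma\|x_t-x^*\|^2\le\alpha^tF(x_0)+\frac{\delta}{1-\alpha}+\delta$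 for all $t\ge1$. That is, $F(x_t)$ converges linearly up to a neighbourhood of radius $O(\delta)$. -/

import Mathlib

open MeasureTheory ProbabilityTheory

/-- One layer of a neural network: `x ↦ σ (W x + b)`, with the activation `σ` acting on every
coordinate. The weight `W` is a matrix, given as a linear map between Euclidean spaces, so that
`‖W‖` is its operator norm. -/
structure Layer (a b : ℕ) where
  weight : EuclideanSpace ℝ (Fin a) →L[ℝ] EuclideanSpace ℝ (Fin b)
  bias : EuclideanSpace ℝ (Fin b)
  activation : ℝ → ℝ

/-- The map computed by a layer. -/
def Layer.toFun {a b : ℕ} (l : Layer a b) (x : EuclideanSpace ℝ (Fin a)) :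
    EuclideanSpace ℝ (Fin b) :=
  WithLp.toLp 2 fun i => l.activation ((l.weight x + l.bias) i)

/-- `Network d k n`: neural networks with `d` layers, `k` inputs and `n` outputs. The widths of the
hidden layers are arbitrary. -/
inductive Network : ℕ → ℕ → ℕ → Type
  | input (k : ℕ) : Network 0 k k
  | layer {d k a b : ℕ} (N : Network d k a) (l : Layer a b) : Network (d + 1) k b

/-- The map `ℝ^k → ℝ^n` computed by a network. -/
def Network.toFun {d k n : ℕ} : Network d k n → EuclideanSpace ℝ (Fin k) → EuclideanSpace ℝ (Fin n)
  | .input _ => fun z => z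
  | .layer N l => fun z => l.toFun (N.toFun z)

/-- In every layer, the weight matrix has operator norm at most `Q` and the activation is
`Q`-Lipschitz. -/
def Network.BoundedBy {d k n : ℕ} : Network d k n → ℝ → Prop
  | .input _, _ => True
  | .layer N l, Q => N.BoundedBy Q ∧ ‖l.weight‖ ≤ Q ∧
      ∀ s t : ℝ, |l.activation s - l.activation t| ≤ Q * |s - t|

/-- The set-restricted eigenvalue condition `S-REC(S, γ, δ)`, in its squared form. -/
def SREC {m n : ℕ} (S : Set (EuclideanSpace ℝ (Fin n))) (A : Matrix (Fin m) (Fin n) ℝ)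
    (γ δ : ℝ) : Prop :=
  ∀ x₁ ∈ S, ∀ x₂ ∈ S, γ * ‖x₁ - x₂‖ ^ 2 - δ ≤ ‖A.toEuclideanLin (x₁ - x₂)‖ ^ 2

/-- The loss `F(x) = ‖y - A x‖²`. -/
noncomputable def pgdLoss {m n : ℕ} (A : Matrix (Fin m) (Fin n) ℝ) (y : EuclideanSpace ℝ (Fin m))
    (x : EuclideanSpace ℝ (Fin n)) : ℝ :=
  ‖y - A.toEuclideanLin x‖ ^ 2

/-- The gradient step `x + η Aᵀ (y - A x)`. -/
noncomputable def pgdStep {m n : ℕ} (A : Matrix (Fin m) (Fin n) ℝ) (y : EuclideanSpace ℝ (Fin m))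
    (η : ℝ) (x : EuclideanSpace ℝ (Fin n)) : EuclideanSpace ℝ (Fin n) :=
  x + η • A.transpose.toEuclideanLin (y - A.toEuclideanLin x)

/-- `x` is a sequence of iterates of projected gradient descent: it starts at `0`, and `x (t + 1)`
is `G z` for a minimiser `z` over `Z` of the distance from `G z` to the gradient step at `x t`. -/
def IsPGD {k m n : ℕ} (A : Matrix (Fin m) (Fin n) ℝ) (y : EuclideanSpace ℝ (Fin m))
    (G : EuclideanSpace ℝ (Fin k) → EuclideanSpace ℝ (Fin n)) (Z : Set (EuclideanSpace ℝ (Fin k)))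
    (η : ℝ) (x : ℕ → EuclideanSpace ℝ (Fin n)) : Prop :=
  x 0 = 0 ∧ ∀ t, ∃ z ∈ Z, IsMinOn (fun z' => ‖pgdStep A y η (x t) - G z'‖) Z z ∧ x (t + 1) = G z

/-- `A` is a random matrix with independent `N(0, 1/m)` entries. -/
def IsGaussianMatrix {Ω : Type*} [MeasurableSpace Ω] (P : Measure Ω) {m n : ℕ}
    (A : Ω → Matrix (Fin m) (Fin n) ℝ) : Prop :=
  iIndepFun (fun (p : Fin m × Fin n) ω => A ω p.1 p.2) P ∧
    ∀ p : Fin m × Fin n, HasLaw (fun ω => A ω p.1 p.2) (gaussianReal 0 (m : NNReal)⁻¹) P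

/-! Everything follows from one deterministic property of `A`: on differences of points of `S ∪
{0}`, `‖A v‖²` equals `‖v‖²` up to a small multiple of `‖v‖²` plus `δ/16`. The point `0` is added
because the iteration starts there.

This property gives S-REC directly and drives the descent. If `A` were an exact isometry on the
differences involved, comparing the new iterate `x'` with the competitor `x*` in the projection
would give `‖x' - x*‖ ≤ 2|1 - η| ‖x - x*‖`. The step size interval and `γ > 2/3` keep `2|1 - η|`
below some `θ < 1`. The rate `α = (1 + θ²)/2`, midway between `θ²` and `1`, leaves room for the
distortion (`pgdStep_ineq`, `pgd_contraction`).

The property holds with high probability by a net argument. For fixed `v`, `A v` has i.i.d. Gaussian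
coordinates, so a Chernoff bound applies. The network is `n^(2Bd)`-Lipschitz, so a fine net of a
latent ball maps to a net of the range whose log-cardinality is `O(k d log n)`; a union bound over
pairs costs only part of the exponent `m`. No chaining is needed: the Hilbert-Schmidt bound `2n` on
`‖A‖²` turns a net error of order `√(δ/n)` into an error of order `δ` (`Network.exists_net_range`,
`abs_norm_sq_sub_le_of_net`). -/

/-! ### Chi-square moment generating function and tails. -/

theorem exp_sq_mul_gaussianPDFReal {v : NNReal} (t x : ℝ) (hv : v ≠ 0) :
    gaussianPDFReal 0 v x • Real.exp (t * x ^ 2) =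
      (√(2 * Real.pi * v))⁻¹ * Real.exp (-((1 - 2 * t * v) / (2 * v)) * x ^ 2) := by
  have : (v : ℝ) ≠ 0 := by exact_mod_cast hv
  rw [gaussianPDFReal, smul_eq_mul, mul_assoc, ← Real.exp_add]
  congr 2
  field_simp
  ring

theorem integrable_exp_mul_sq_gaussianReal {v : NNReal} {t : ℝ} (hv : v ≠ 0)
    (ht : 2 * t * v < 1) : Integrable (fun x => Real.exp (t * x ^ 2)) (gaussianReal 0 v) := by
  have hv' : (0 : ℝ) < v := by exact_mod_cast pos_iff_ne_zero.2 hv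
  rw [gaussianReal_of_var_ne_zero _ hv, integrable_withDensity_iff_integrable_smul'
    (measurable_gaussianPDF _ _) (ae_of_all _ fun _ => gaussianPDF_lt_top)]
  simp_rw [toReal_gaussianPDF, exp_sq_mul_gaussianPDFReal _ _ hv]
  exact (integrable_exp_neg_mul_sq (div_pos (by linarith) (by positivity))).const_mul _

theorem integral_exp_mul_sq_gaussianReal {v : NNReal} {t : ℝ} (hv : v ≠ 0)
    (ht : 2 * t * v < 1) :
    ∫ x, Real.exp (t * x ^ 2) ∂gaussianReal 0 v = (√(1 - 2 * t * v))⁻¹ := by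
  have hv' : (0 : ℝ) < v := by exact_mod_cast pos_iff_ne_zero.2 hv
  have h1 : 0 < 1 - 2 * t * v := by linarith
  rw [integral_gaussianReal_eq_integral_smul hv]
  simp_rw [exp_sq_mul_gaussianPDFReal _ _ hv]
  rw [integral_const_mul, integral_gaussian, ← Real.sqrt_inv, ← Real.sqrt_inv,
    ← Real.sqrt_mul (by positivity)]
  congr 1
  field_simp

section ChiSquare

variable {Ω ι : Type*} [MeasurableSpace Ω] {P : Measure Ω}
  {Y : ι → Ω → ℝ} {v : NNReal}

theorem integrable_exp_mul_sq_of_hasLaw {X : Ω → ℝ} {t : ℝ} (hX : HasLaw X (gaussianReal 0 v) P)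
    (hv : v ≠ 0) (ht : 2 * t * v < 1) : Integrable (fun ω => Real.exp (t * X ω ^ 2)) P := by
  have h := integrable_exp_mul_sq_gaussianReal hv ht
  rw [← hX.map_eq] at h
  exact h.comp_aemeasurable hX.aemeasurable

theorem mgf_sq_of_hasLaw {X : Ω → ℝ} {t : ℝ} (hX : HasLaw X (gaussianReal 0 v) P)
    (hv : v ≠ 0) (ht : 2 * t * v < 1) :
    mgf (fun ω => X ω ^ 2) P t = (√(1 - 2 * t * v))⁻¹ := by
  rw [← integral_exp_mul_sq_gaussianReal hv ht]
  exact hX.integral_comp (f := fun x => Real.exp (t * x ^ 2)) (by fun_prop)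

theorem iIndepFun.sq (hY : iIndepFun Y P) : iIndepFun (fun i ω => Y i ω ^ 2) P :=
  hY.comp (fun _ x => x ^ 2) (fun _ => by fun_prop)

variable [Fintype ι]

theorem mgf_sum_sq (hY : iIndepFun Y P) (hl : ∀ i, HasLaw (Y i) (gaussianReal 0 v) P)
    (hv : v ≠ 0) {t : ℝ} (ht : 2 * t * v < 1) :
    mgf (fun ω => ∑ i, Y i ω ^ 2) P t =
      Real.exp (-(Fintype.card ι / 2 * Real.log (1 - 2 * t * v))) := by
  have hm : ∀ i, AEMeasurable (fun ω => Y i ω ^ 2) P := fun i => (hl i).aemeasurable.pow_const 2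
  have h := (iIndepFun.sq hY).mgf_sum₀ (t := t) hm Finset.univ
  have h1 : 0 < 1 - 2 * t * v := by linarith
  have e : (∑ i, fun ω => Y i ω ^ 2) = fun ω => ∑ i, Y i ω ^ 2 := by
    ext ω; simp
  rw [e] at h
  rw [h, Finset.prod_congr rfl fun i _ => mgf_sq_of_hasLaw (hl i) hv ht, Finset.prod_const,
    Finset.card_univ]
  have : (√(1 - 2 * t * v))⁻¹ = Real.exp (-(1 / 2 * Real.log (1 - 2 * t * v))) := by
    rw [Real.exp_neg, Real.sqrt_eq_rpow, Real.rpow_def_of_pos h1, mul_comm]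
  rw [this, ← Real.exp_nat_mul]
  congr 1
  ring

theorem integrable_exp_mul_sum_sq (hY : iIndepFun Y P)
    (hl : ∀ i, HasLaw (Y i) (gaussianReal 0 v) P)
    (hv : v ≠ 0) {t : ℝ} (ht : 2 * t * v < 1) :
    Integrable (fun ω => Real.exp (t * ∑ i, Y i ω ^ 2)) P := by
  -- `mgf` takes the value `0` when the exponential is not integrable, which the positive closed
  -- form excludes.
  by_contra h
  have h1 := mgf_sum_sq hY hl hv ht
  rw [mgf_undef h] at h1
  exact (Real.exp_pos _).ne h1

theorem measure_sum_sq_ge_le [IsFiniteMeasure P] (hY : iIndepFun Y P) (hl : ∀ i, HasLaw (Y i) (gaussianReal 0 v) P)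
    (hv : v ≠ 0) {ε : ℝ} (hε : 0 < ε) :
    P.real {ω | (1 + ε) * (Fintype.card ι * v) ≤ ∑ i, Y i ω ^ 2} ≤
      Real.exp (-((ε - Real.log (1 + ε)) / 2 * Fintype.card ι)) := by
  have hv' : (0 : ℝ) < v := by exact_mod_cast pos_iff_ne_zero.2 hv
  -- The optimal Chernoff parameter, chosen so that `1 - 2tv = (1 + ε)⁻¹`.
  set t : ℝ := ε / (1 + ε) / (2 * v) with ht_def
  have e1 : 1 - 2 * t * v = (1 + ε)⁻¹ := by rw [ht_def]; field_simp; ring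
  have ht : 2 * t * v < 1 := by
    have : (0 : ℝ) < (1 + ε)⁻¹ := by positivity
    linarith
  refine (measure_ge_le_exp_mul_mgf _ (by positivity)
    (integrable_exp_mul_sum_sq hY hl hv ht)).trans_eq ?_
  rw [mgf_sum_sq hY hl hv ht, ← Real.exp_add, e1, Real.log_inv]
  congr 1
  rw [ht_def]
  field_simp
  ring

theorem measure_sum_sq_le_le [IsFiniteMeasure P] (hY : iIndepFun Y P) (hl : ∀ i, HasLaw (Y i) (gaussianReal 0 v) P)
    (hv : v ≠ 0) {ε : ℝ} (hε : 0 < ε) (hε1 : ε < 1) :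
    P.real {ω | ∑ i, Y i ω ^ 2 ≤ (1 - ε) * (Fintype.card ι * v)} ≤
      Real.exp (-((-ε - Real.log (1 - ε)) / 2 * Fintype.card ι)) := by
  have hv' : (0 : ℝ) < v := by exact_mod_cast pos_iff_ne_zero.2 hv
  have h1 : 0 < 1 - ε := by linarith
  set t : ℝ := -(ε / (1 - ε) / (2 * v)) with ht_def
  have e1 : 1 - 2 * t * v = (1 - ε)⁻¹ := by rw [ht_def]; field_simp; ring
  have ht : 2 * t * v < 1 := by
    have : (0 : ℝ) < (1 - ε)⁻¹ := by positivity
    linarith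
  refine (measure_le_le_exp_mul_mgf _ (by rw [ht_def, neg_nonpos]; positivity)
    (integrable_exp_mul_sum_sq hY hl hv ht)).trans_eq ?_
  rw [mgf_sum_sq hY hl hv ht, ← Real.exp_add, e1, Real.log_inv]
  congr 1
  rw [ht_def]
  field_simp
  ring

end ChiSquare

/-! ### The law of a Gaussian matrix applied to a fixed vector. -/

section GaussianMatrix

variable {Ω : Type*} [MeasurableSpace Ω] {P : Measure Ω} {m n : ℕ}
  {A : Ω → Matrix (Fin m) (Fin n) ℝ}

theorem IsGaussianMatrix.hasGaussianLaw (hA : IsGaussianMatrix P A) :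
    HasGaussianLaw (fun ω (p : Fin m × Fin n) => A ω p.1 p.2) P :=
  hA.1.hasGaussianLaw fun p => (hA.2 p).hasGaussianLaw

theorem IsGaussianMatrix.covariance_eq_zero (hA : IsGaussianMatrix P A)
    {p q : Fin m × Fin n} (h : p ≠ q) : cov[fun ω => A ω p.1 p.2, fun ω => A ω q.1 q.2; P] = 0 :=
  (hA.1.indepFun h).covariance_eq_zero (hA.2 p).hasGaussianLaw.memLp_two
    (hA.2 q).hasGaussianLaw.memLp_two

theorem IsGaussianMatrix.memLp_mul (hA : IsGaussianMatrix P A) (v : Fin n → ℝ) (i : Fin m)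
    (j : Fin n) : MemLp (fun ω => A ω i j * v j) 2 P :=
  (hA.2 (i, j)).hasGaussianLaw.memLp_two.mul_const _

theorem IsGaussianMatrix.hasGaussianLaw_mulVec (hA : IsGaussianMatrix P A) (v : Fin n → ℝ) :
    HasGaussianLaw (fun ω (i : Fin m) => ∑ j, A ω i j * v j) P := by
  let L : (Fin m × Fin n → ℝ) →L[ℝ] (Fin m → ℝ) :=
    ContinuousLinearMap.pi fun i => ∑ j, v j • ContinuousLinearMap.proj (i, j)
  have h : (fun ω (i : Fin m) => ∑ j, A ω i j * v j) =
      fun ω => L fun p => A ω p.1 p.2 := by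
    ext ω i
    simp [L, mul_comm]
  rw [h]
  exact hA.hasGaussianLaw.map_fun L

/-- The coordinates are jointly Gaussian, so vanishing covariances suffice; distinct rows share no
entry. -/
theorem IsGaussianMatrix.iIndepFun_mulVec (hA : IsGaussianMatrix P A) (v : Fin n → ℝ) :
    iIndepFun (fun (i : Fin m) ω => ∑ j, A ω i j * v j) P := by
  have := hA.1.isProbabilityMeasure
  refine (hA.hasGaussianLaw_mulVec v).iIndepFun_of_covariance_eq_zero fun i i' hi => ?_
  rw [covariance_fun_sum_fun_sum (hA.memLp_mul v i) (hA.memLp_mul v i')]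
  refine Finset.sum_eq_zero fun j _ => Finset.sum_eq_zero fun j' _ => ?_
  rw [covariance_mul_const_left, covariance_mul_const_right,
    hA.covariance_eq_zero (p := (i, j)) (q := (i', j')) (by simp [hi])]
  simp

theorem IsGaussianMatrix.hasLaw_mulVec (hA : IsGaussianMatrix P A) (v : EuclideanSpace ℝ (Fin n))
    (i : Fin m) :
    HasLaw (fun ω => ∑ j, A ω i j * v j) (gaussianReal 0 ((m : NNReal)⁻¹ * ‖v‖₊ ^ 2)) P := by
  have := hA.1.isProbabilityMeasure
  have hg := (hA.hasGaussianLaw_mulVec v).eval i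
  refine ⟨hg.aemeasurable, ?_⟩
  rw [hg.map_eq_gaussianReal]
  have hmean : ∫ ω, ∑ j, A ω i j * v j ∂P = 0 := by
    rw [integral_finsetSum _ fun j _ => (hA.memLp_mul v i j).integrable (by norm_num)]
    refine Finset.sum_eq_zero fun j _ => ?_
    have := (hA.2 (i, j)).integral_eq
    rw [integral_id_gaussianReal] at this
    rw [integral_mul_const, this, zero_mul]
  have hvar : Var[fun ω => ∑ j, A ω i j * v j; P] = (m : ℝ)⁻¹ * ‖v‖ ^ 2 := by
    rw [variance_fun_sum (hA.memLp_mul v i), EuclideanSpace.real_norm_sq_eq, Finset.mul_sum]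
    refine Finset.sum_congr rfl fun j _ => ?_
    rw [Finset.sum_eq_single j]
    · rw [covariance_self (hA.memLp_mul v i j).aemeasurable, variance_mul_const,
        (hA.2 (i, j)).variance_eq, variance_id_gaussianReal]
      simp
    · intro j' _ hj
      rw [covariance_mul_const_left, covariance_mul_const_right,
        hA.covariance_eq_zero (p := (i, j)) (q := (i, j')) (by simp [hj.symm])]
      simp
    · simp
  rw [hmean, hvar]
  congr 1
  ext
  simp [Real.coe_toNNReal']
  positivity

end GaussianMatrix

/-- The exponential rate at which `‖A v‖²` concentrates around `‖v‖²` up to a relative error `ε`,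
for a Gaussian matrix `A` with normalised entries. -/
noncomputable def concentrationRate (ε : ℝ) : ℝ :=
  min ((ε - Real.log (1 + ε)) / 2) ((-ε - Real.log (1 - ε)) / 2)

theorem concentrationRate_pos {ε : ℝ} (hε : 0 < ε) (hε1 : ε < 1) : 0 < concentrationRate ε := by
  have h1 := Real.log_lt_sub_one_of_pos (show 0 < 1 + ε by linarith) (by linarith)
  have h2 := Real.log_lt_sub_one_of_pos (show 0 < 1 - ε by linarith) (by linarith)
  exact lt_min (by linarith) (by linarith)

/-! ### Concentration of `‖A v‖²` and union bound over a finite set. -/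

section GaussianMatrixConcentration

theorem Matrix.norm_sq_toEuclideanLin {m n : ℕ} (A : Matrix (Fin m) (Fin n) ℝ)
    (v : EuclideanSpace ℝ (Fin n)) :
    ‖A.toEuclideanLin v‖ ^ 2 = ∑ i, (∑ j, A i j * v j) ^ 2 := by
  rw [EuclideanSpace.real_norm_sq_eq]
  simp [Matrix.toLpLin_apply, Matrix.mulVec, dotProduct]

theorem Matrix.norm_sq_toEuclideanLin_le {m n : ℕ} (A : Matrix (Fin m) (Fin n) ℝ)
    (v : EuclideanSpace ℝ (Fin n)) :
    ‖A.toEuclideanLin v‖ ^ 2 ≤ (∑ p : Fin m × Fin n, A p.1 p.2 ^ 2) * ‖v‖ ^ 2 := by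
  rw [A.norm_sq_toEuclideanLin, Fintype.sum_prod_type, Finset.sum_mul,
    EuclideanSpace.real_norm_sq_eq]
  exact Finset.sum_le_sum fun i _ => Finset.sum_mul_sq_le_sq_mul_sq _ _ _

variable {Ω : Type*} [MeasurableSpace Ω] {P : Measure Ω} {m n : ℕ}
  {A : Ω → Matrix (Fin m) (Fin n) ℝ}

theorem IsGaussianMatrix.measure_norm_sq_sub_le (hA : IsGaussianMatrix P A) (hm : 0 < m) {ε : ℝ}
    (hε : 0 < ε) (hε1 : ε < 1) (v : EuclideanSpace ℝ (Fin n)) :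
    P {ω | ε * ‖v‖ ^ 2 < |‖(A ω).toEuclideanLin v‖ ^ 2 - ‖v‖ ^ 2|} ≤
      2 * ENNReal.ofReal (Real.exp (-concentrationRate ε * m)) := by
  have := hA.1.isProbabilityMeasure
  -- For `v = 0` the variance degenerates, but the strict inequality makes the event empty.
  rcases eq_or_ne v 0 with rfl | hv
  · simp
  have hm0 : (m : NNReal) ≠ 0 := by exact_mod_cast hm.ne'
  have hvar : (m : NNReal)⁻¹ * ‖v‖₊ ^ 2 ≠ 0 := by
    have : ‖v‖₊ ≠ 0 := by simpa using hv
    positivity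
  have hsum : ((Fintype.card (Fin m) : ℝ) * ((m : NNReal)⁻¹ * ‖v‖₊ ^ 2 : NNReal)) = ‖v‖ ^ 2 := by
    have : (m : ℝ) ≠ 0 := by exact_mod_cast hm.ne'
    simp [this]
  have hup := measure_sum_sq_ge_le (hA.iIndepFun_mulVec v) (hA.hasLaw_mulVec v) hvar hε
  have hlo := measure_sum_sq_le_le (hA.iIndepFun_mulVec v) (hA.hasLaw_mulVec v) hvar hε hε1
  rw [hsum, Fintype.card_fin] at hup hlo
  rw [two_mul]
  refine (measure_mono (t := {ω | (1 + ε) * ‖v‖ ^ 2 ≤ ∑ i, (∑ j, A ω i j * v j) ^ 2} ∪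
    {ω | ∑ i, (∑ j, A ω i j * v j) ^ 2 ≤ (1 - ε) * ‖v‖ ^ 2}) fun ω hω => ?_).trans
    ((measure_union_le _ _).trans (add_le_add ?_ ?_))
  · simp only [Set.mem_ofPred_eq, Matrix.norm_sq_toEuclideanLin, lt_abs, Set.mem_union] at hω ⊢
    rcases hω with h | h
    · left; linarith
    · right; linarith
  · rw [← ofReal_measureReal]
    refine ENNReal.ofReal_le_ofReal (hup.trans (Real.exp_le_exp.2 ?_))
    rw [← neg_mul]
    gcongr
    exact min_le_left _ _
  · rw [← ofReal_measureReal]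
    refine ENNReal.ofReal_le_ofReal (hlo.trans (Real.exp_le_exp.2 ?_))
    rw [← neg_mul]
    gcongr
    exact min_le_right _ _

/-- The sum has mean `n`, and `2n ≥ (1 + ε)n`; having `mn ≥ m` summands only improves the exponent.
-/
theorem IsGaussianMatrix.measure_sum_sq_entries_le (hA : IsGaussianMatrix P A) (hm : 0 < m)
    (hn : 0 < n) {ε : ℝ} (hε : 0 < ε) (hε1 : ε < 1) :
    P {ω | 2 * n < ∑ p : Fin m × Fin n, A ω p.1 p.2 ^ 2} ≤
      ENNReal.ofReal (Real.exp (-concentrationRate ε * m)) := by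
  have := hA.1.isProbabilityMeasure
  have hm0 : (m : NNReal) ≠ 0 := by exact_mod_cast hm.ne'
  have hup := measure_sum_sq_ge_le hA.1 hA.2 (inv_ne_zero hm0) hε
  have hsum : (Fintype.card (Fin m × Fin n) : ℝ) * ((m : NNReal)⁻¹ : NNReal) = n := by
    have : (m : ℝ) ≠ 0 := by exact_mod_cast hm.ne'
    simp
    field_simp
  rw [hsum] at hup
  refine (measure_mono fun ω hω => ?_).trans ((ofReal_measureReal).symm.trans_le
    (ENNReal.ofReal_le_ofReal (hup.trans (Real.exp_le_exp.2 ?_))))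
  · simp only [Set.mem_ofPred_eq] at hω ⊢
    refine le_trans ?_ hω.le
    gcongr
    linarith
  · have h1 : (1 : ℝ) ≤ n := by exact_mod_cast hn
    have h2 := concentrationRate_pos hε hε1
    have h3 : concentrationRate ε ≤ (ε - Real.log (1 + ε)) / 2 := min_le_left _ _
    have h4 : (m : ℝ) ≤ Fintype.card (Fin m × Fin n) := by
      simp only [Fintype.card_prod, Fintype.card_fin, Nat.cast_mul]
      exact le_mul_of_one_le_right (by positivity) h1
    rw [neg_mul, neg_le_neg_iff]
    exact mul_le_mul h3 h4 (by positivity) (h2.le.trans h3)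

/-- A finite set is mapped almost isometrically by a Gaussian matrix, whose Hilbert-Schmidt norm
is also controlled. -/
theorem IsGaussianMatrix.measure_exists_not_near_isometry_le (hA : IsGaussianMatrix P A)
    (hm : 0 < m) (hn : 0 < n) {ε : ℝ} (hε : 0 < ε) (hε1 : ε < 1)
    (T : Finset (EuclideanSpace ℝ (Fin n))) :
    P {ω | (∃ p ∈ T, ∃ q ∈ T,
        ε * ‖p - q‖ ^ 2 < |‖(A ω).toEuclideanLin (p - q)‖ ^ 2 - ‖p - q‖ ^ 2|) ∨
        2 * n < ∑ p : Fin m × Fin n, A ω p.1 p.2 ^ 2} ≤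
      ENNReal.ofReal ((2 * T.card ^ 2 + 1) * Real.exp (-concentrationRate ε * m)) := by
  set b := ENNReal.ofReal (Real.exp (-concentrationRate ε * m)) with hb
  have h1 : P {ω | ∃ p ∈ T, ∃ q ∈ T,
      ε * ‖p - q‖ ^ 2 < |‖(A ω).toEuclideanLin (p - q)‖ ^ 2 - ‖p - q‖ ^ 2|} ≤
      ∑ r ∈ T ×ˢ T, 2 * b := by
    refine (measure_mono fun ω hω => ?_).trans ((measure_biUnion_finset_le (T ×ˢ T) fun r =>
      {ω | ε * ‖r.1 - r.2‖ ^ 2 < |‖(A ω).toEuclideanLin (r.1 - r.2)‖ ^ 2 - ‖r.1 - r.2‖ ^ 2|}).trans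
      (Finset.sum_le_sum fun r _ => hA.measure_norm_sq_sub_le hm hε hε1 _))
    obtain ⟨p, hp, q, hq, h⟩ := hω
    exact Set.mem_biUnion (x := (p, q)) (by simp [hp, hq]) h
  refine (measure_union_le _ _).trans
    ((add_le_add h1 (hA.measure_sum_sq_entries_le hm hn hε hε1)).trans_eq ?_)
  rw [ENNReal.ofReal_mul (by positivity), ← hb, Finset.sum_const, Finset.card_product, nsmul_eq_mul,
    ENNReal.ofReal_add (by positivity) (by positivity), add_mul, ENNReal.ofReal_one, one_mul,
    ENNReal.ofReal_mul (by positivity), ENNReal.ofReal_pow (by positivity), ENNReal.ofReal_natCast]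
  push_cast
  rw [ENNReal.ofReal_ofNat]
  ring

end GaussianMatrixConcentration

/-! ### Volumetric covering numbers of balls. -/

section Covering

variable {E : Type*} [NormedAddCommGroup E] [NormedSpace ℝ E] [FiniteDimensional ℝ E]

/-- Balls of radius `s/2` about the points are disjoint and lie in the ball of radius `R + s/2`;
compare volumes. -/
theorem card_le_of_separated_of_norm_le {R s : ℝ} (hs : 0 < s) (hR : 0 ≤ R)
    (T : Finset E) (hT : ∀ x ∈ T, ‖x‖ ≤ R) (hsep : (T : Set E).Pairwise fun x y => s ≤ ‖x - y‖) :
    (T.card : ℝ) ≤ (1 + 2 * R / s) ^ Module.finrank ℝ E := by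
  borelize E
  let μ : Measure E := Measure.addHaar
  have hr : 0 < s / 2 := by positivity
  have hρ : 0 < R + s / 2 := by positivity
  have hdisj : (T : Set E).PairwiseDisjoint fun c => Metric.ball c (s / 2) := by
    intro c hc d hd hcd
    apply Metric.ball_disjoint_ball
    rw [dist_eq_norm]
    linarith [hsep hc hd hcd]
  have hsub : (⋃ c ∈ T, Metric.ball c (s / 2)) ⊆ Metric.ball (0 : E) (R + s / 2) := by
    refine Set.iUnion₂_subset fun x hx => Metric.ball_subset_ball' ?_
    rw [dist_zero_right]
    linarith [hT x hx]
  have hμ : (T.card : ENNReal) * ENNReal.ofReal ((s / 2) ^ Module.finrank ℝ E) * μ (Metric.ball 0 1)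
      ≤ ENNReal.ofReal ((R + s / 2) ^ Module.finrank ℝ E) * μ (Metric.ball 0 1) := by
    rw [← μ.addHaar_ball_of_pos 0 hρ]
    refine le_trans (le_of_eq ?_) (measure_mono hsub)
    rw [measure_biUnion_finset hdisj fun c _ => measurableSet_ball]
    simp only [μ.addHaar_ball_of_pos _ hr, Finset.sum_const, nsmul_eq_mul, mul_assoc]
  have h := ENNReal.toReal_le_of_le_ofReal (pow_nonneg hρ.le _)
    ((ENNReal.mul_le_mul_iff_left (Metric.measure_ball_pos _ _ zero_lt_one).ne'
      measure_ball_lt_top.ne).1 hμ)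
  rw [ENNReal.toReal_mul, ENNReal.toReal_natCast, ENNReal.toReal_ofReal (by positivity)] at h
  have e : 1 + 2 * R / s = (R + s / 2) / (s / 2) := by field_simp; ring
  rwa [e, div_pow, le_div_iff₀ (by positivity)]

/-- A separated set of maximal cardinality is a net: an uncovered point could be added to it. -/
theorem exists_finset_cover_closedBall {R s : ℝ} (hs : 0 < s) (hR : 0 ≤ R) :
    ∃ T : Finset E, (T.card : ℝ) ≤ (1 + 2 * R / s) ^ Module.finrank ℝ E ∧
      ∀ x : E, ‖x‖ ≤ R → ∃ y ∈ T, ‖x - y‖ ≤ s := by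
  classical
  let IsSep : Finset E → Prop := fun T =>
    (∀ x ∈ T, ‖x‖ ≤ R) ∧ (T : Set E).Pairwise fun x y => s ≤ ‖x - y‖
  have hcard : ∀ T, IsSep T → (T.card : ℝ) ≤ (1 + 2 * R / s) ^ Module.finrank ℝ E :=
    fun T hT => card_le_of_separated_of_norm_le hs hR T hT.1 hT.2
  let C : Set ℕ := {j | ∃ T, IsSep T ∧ T.card = j}
  have hne : C.Nonempty := ⟨0, ∅, ⟨by simp, by simp⟩, rfl⟩
  have hbdd : BddAbove C := by
    refine ⟨⌊(1 + 2 * R / s) ^ Module.finrank ℝ E⌋₊, ?_⟩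
    rintro _ ⟨T, hT, rfl⟩
    exact Nat.le_floor (hcard T hT)
  obtain ⟨T, hT, hTmax⟩ := Nat.sSup_mem hne hbdd
  refine ⟨T, hcard T hT, fun x hx => ?_⟩
  by_contra! hfar
  have hxT : x ∉ T := fun h => by
    have := hfar x h
    rw [sub_self, norm_zero] at this
    linarith
  have hins : IsSep (insert x T) := by
    refine ⟨fun y hy => ?_, ?_⟩
    · rcases Finset.mem_insert.1 hy with rfl | hy
      · exact hx
      · exact hT.1 y hy
    · rw [Finset.coe_insert]
      refine hT.2.insert fun y hy _ => ⟨(hfar y hy).le, ?_⟩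
      rw [norm_sub_rev]
      exact (hfar y hy).le
  have := le_csSup hbdd ⟨insert x T, hins, rfl⟩
  rw [Finset.card_insert_of_notMem hxT, ← hTmax] at this
  omega

end Covering

/-! ### Lipschitz bounds for networks. -/

section Lipschitz

theorem Layer.norm_toFun_sub_le {a b : ℕ} (l : Layer a b) {Q : ℝ} (hQ : 0 ≤ Q)
    (hw : ‖l.weight‖ ≤ Q)
    (hσ : ∀ s t : ℝ, |l.activation s - l.activation t| ≤ Q * |s - t|)
    (x y : EuclideanSpace ℝ (Fin a)) : ‖l.toFun x - l.toFun y‖ ≤ Q ^ 2 * ‖x - y‖ := by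
  have h1 : ‖l.toFun x - l.toFun y‖ ≤ Q * ‖l.weight (x - y)‖ := by
    refine le_of_sq_le_sq ?_ (by positivity)
    rw [mul_pow, EuclideanSpace.real_norm_sq_eq, EuclideanSpace.real_norm_sq_eq, Finset.mul_sum]
    refine Finset.sum_le_sum fun i _ => ?_
    rw [← mul_pow, ← sq_abs, ← sq_abs (Q * _)]
    refine pow_le_pow_left₀ (abs_nonneg _) ?_ 2
    have := hσ ((l.weight x + l.bias) i) ((l.weight y + l.bias) i)
    simpa [Layer.toFun, abs_mul, abs_of_nonneg hQ] using this
  calc ‖l.toFun x - l.toFun y‖ ≤ Q * ‖l.weight (x - y)‖ := h1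
    _ ≤ Q * (Q * ‖x - y‖) := by
      gcongr
      exact (l.weight.le_opNorm _).trans (by gcongr)
    _ = Q ^ 2 * ‖x - y‖ := by ring

theorem Network.norm_toFun_sub_le {d k n : ℕ} (N : Network d k n) {Q : ℝ} (hQ : 0 ≤ Q)
    (hN : N.BoundedBy Q) (x y : EuclideanSpace ℝ (Fin k)) :
    ‖N.toFun x - N.toFun y‖ ≤ Q ^ (2 * d) * ‖x - y‖ := by
  induction N with
  | input k => simp [Network.toFun]
  | @layer d k a b N l ih =>
    obtain ⟨hN, hw, hσ⟩ := hN
    calc _ ≤ Q ^ 2 * ‖N.toFun x - N.toFun y‖ := l.norm_toFun_sub_le hQ hw hσ _ _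
      _ ≤ Q ^ 2 * (Q ^ (2 * d) * ‖x - y‖) := by gcongr; exact ih hN x y
      _ = Q ^ (2 * (d + 1)) * ‖x - y‖ := by ring

end Lipschitz

/-! ### Stability of near isometry under perturbation. -/

section NearIsometry

theorem norm_add_sq_le_weighted {E : Type*} [SeminormedAddCommGroup E] {ε : ℝ} (hε : 0 < ε)
    (hε1 : ε ≤ 1) (a b : E) : ‖a + b‖ ^ 2 ≤ (1 + ε) * ‖a‖ ^ 2 + 2 / ε * ‖b‖ ^ 2 := by
  have h1 : ‖a + b‖ ^ 2 ≤ (‖a‖ + ‖b‖) ^ 2 :=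
    pow_le_pow_left₀ (norm_nonneg _) (norm_add_le a b) 2
  have h2 : 2 / ε * ‖b‖ ^ 2 ≥ (1 + 1 / ε) * ‖b‖ ^ 2 := by
    refine mul_le_mul_of_nonneg_right ?_ (sq_nonneg _)
    rw [← sub_nonneg]
    have : 2 / ε - (1 + 1 / ε) = (1 - ε) / ε := by field_simp; ring
    rw [this]
    exact div_nonneg (by linarith) hε.le
  have h3 : 0 ≤ (ε * ‖a‖ - ‖b‖) ^ 2 / ε := by positivity
  have h4 : (ε * ‖a‖ - ‖b‖) ^ 2 / ε = ε * ‖a‖ ^ 2 - 2 * ‖a‖ * ‖b‖ + 1 / ε * ‖b‖ ^ 2 := by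
    field_simp
    ring
  nlinarith

/-- Pass from `g + e` to `g`, to `L g`, to `L (g + e)`, and back. Each passage costs a factor of
about `1 + ε`, by the weighted Young inequality or by `hg`, and `(1 + ε)³ ≤ 1 + 7ε`. -/
theorem abs_norm_sq_sub_le_of_add {E F : Type*} [SeminormedAddCommGroup E]
    [SeminormedAddCommGroup F] [Module ℝ E] [Module ℝ F] (L : E →ₗ[ℝ] F) {ε : ℝ} (hε : 0 < ε)
    (hε1 : ε ≤ 1) {g e : E} (hg : |‖L g‖ ^ 2 - ‖g‖ ^ 2| ≤ ε * ‖g‖ ^ 2) :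
    |‖L (g + e)‖ ^ 2 - ‖g + e‖ ^ 2| ≤
      7 * ε * ‖g + e‖ ^ 2 + (8 / ε * ‖e‖ ^ 2 + 4 / ε * ‖L e‖ ^ 2) := by
  rw [abs_le] at hg
  obtain ⟨hg1, hg2⟩ := hg
  have a1 := norm_add_sq_le_weighted hε hε1 (L g) (L e)
  have a2 := norm_add_sq_le_weighted hε hε1 (L (g + e)) (-L e)
  have a3 := norm_add_sq_le_weighted hε hε1 g e
  have a4 := norm_add_sq_le_weighted hε hε1 (g + e) (-e)
  rw [map_add, add_neg_cancel_right, norm_neg] at a2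
  rw [add_neg_cancel_right, norm_neg] at a4
  rw [map_add]
  set X := ‖g + e‖ ^ 2
  set Y := ‖L g + L e‖ ^ 2
  set p := 1 / ε * ‖e‖ ^ 2 with hp
  set q := 1 / ε * ‖L e‖ ^ 2 with hq
  have ep (c : ℝ) : c / ε * ‖e‖ ^ 2 = c * p := by rw [hp]; ring
  have eq (c : ℝ) : c / ε * ‖L e‖ ^ 2 = c * q := by rw [hq]; ring
  rw [ep] at a3 a4 ⊢
  rw [eq] at a1 a2 ⊢
  have hp0 : 0 ≤ p := by positivity
  have hq0 : 0 ≤ q := by positivity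
  have hX0 : 0 ≤ X := by positivity
  have hY0 : 0 ≤ Y := by positivity
  have hεε : ε * ε ≤ ε := by nlinarith
  have hεX : 0 ≤ ε * X := by positivity
  rw [abs_le]
  constructor
  · have b1 : (1 - ε) * X ≤ (1 - ε) * ((1 + ε) * ‖g‖ ^ 2 + 2 * p) :=
      mul_le_mul_of_nonneg_left a3 (by linarith)
    have b2 : (1 + ε) * ((1 - ε) * ‖g‖ ^ 2) ≤ (1 + ε) * ((1 + ε) * Y + 2 * q) :=
      mul_le_mul_of_nonneg_left (by linarith) (by linarith)
    have b3 : (1 - ε) * X ≤ (1 + 3 * ε) * Y + (4 * q + 2 * p) := by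
      nlinarith [mul_nonneg hε.le hp0, mul_le_mul_of_nonneg_right hε1 hq0,
        mul_le_mul_of_nonneg_right hεε hY0]
    by_contra! hc
    have b4 : (1 + 3 * ε) * Y ≤ (1 + 3 * ε) * ((1 - 7 * ε) * X - (8 * p + 4 * q)) :=
      mul_le_mul_of_nonneg_left (by linarith) (by linarith)
    nlinarith [mul_nonneg hε.le hp0, mul_nonneg hε.le hq0, mul_nonneg hε.le hεX]
  · have b1 : (1 + ε) * ‖L g‖ ^ 2 ≤ (1 + ε) * ((1 + ε) * ((1 + ε) * X + 2 * p)) :=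
      mul_le_mul_of_nonneg_left
        ((show ‖L g‖ ^ 2 ≤ (1 + ε) * ‖g‖ ^ 2 by linarith).trans
          (mul_le_mul_of_nonneg_left a4 (by linarith))) (by linarith)
    have c1 : (1 + ε) * (1 + ε) ≤ 1 + 3 * ε := by nlinarith
    have c2 : (1 + ε) * ((1 + ε) * (1 + ε)) ≤ 1 + 7 * ε := by nlinarith
    nlinarith [mul_le_mul_of_nonneg_right c1 hp0, mul_le_mul_of_nonneg_right c2 hX0,
      mul_le_mul_of_nonneg_right hε1 hp0]

end NearIsometry

/-! ### Deterministic analysis of projected gradient descent. -/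

section ProjectedGradient

/-- The scalar core of one step: `h`, `w`, `u` stand for `‖x - x*‖`, `‖x' - x*‖`, `‖x' - x‖`, and
`AH`, `AW`, `AU` for the squared norms of the images under `A`. Without distortion, `hstep` and the
triangle inequalities force `w ≤ θ h`. -/
theorem pgd_contraction {h u w AH AU AW η θ ε ρ : ℝ} (hh : 0 ≤ h) (hw : 0 ≤ w)
    (huw : u ≤ w + h) (hhu : h ≤ u + w) (hwu : w ≤ u + h) (hu : 0 ≤ u) (hη : |1 - η| ≤ θ / 2) (hθ : θ < 1)
    (hε : 0 < ε) (hεθ : 60 * ε ≤ 1 - θ ^ 2) (hρ : 0 ≤ ρ)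
    (hH : |AH - h ^ 2| ≤ ε * h ^ 2 + ρ) (hU : |AU - u ^ 2| ≤ ε * u ^ 2 + ρ)
    (hW : |AW - w ^ 2| ≤ ε * w ^ 2 + ρ)  (hAH : 0 ≤ AH)
    (hstep : u ^ 2 + η * AW ≤ h ^ 2 - η * AH + η * AU) :
    AW ≤ (1 + θ ^ 2) / 2 * AH + 16 * ρ := by
  rw [abs_le] at hH hU hW hη
  have hθ0 : 0 ≤ θ := by linarith
  have hη0 : 0 < η := by linarith
  have hη1 : η ≤ 3 / 2 := by linarith
  have hε1 : 60 * ε ≤ 1 := by nlinarith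
  have hhw : 0 ≤ h * w := by positivity
  have hu2 : u ^ 2 ≤ (w + h) ^ 2 := pow_le_pow_left₀ hu huw 2
  have hS : η * (ε * w ^ 2 + ε * h ^ 2 + ε * u ^ 2 + 3 * ρ) ≤
      9 / 2 * (ε * w ^ 2 + ε * h ^ 2) + 9 / 2 * ρ := by
    have : ε * u ^ 2 ≤ 2 * (ε * w ^ 2 + ε * h ^ 2) := by
      nlinarith [mul_nonneg hε.le (sq_nonneg (w - h)), mul_le_mul_of_nonneg_left hu2 hε.le]
    have h0 : 0 ≤ ε * w ^ 2 + ε * h ^ 2 + ρ := by positivity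
    nlinarith [mul_le_mul_of_nonneg_left this hη0.le, mul_le_mul_of_nonneg_right hη1 h0]
  have hlin : u ^ 2 * (1 - η) + η * w ^ 2 ≤ h ^ 2 * (1 - η) +
      η * (ε * w ^ 2 + ε * h ^ 2 + ε * u ^ 2 + 3 * ρ) := by
    nlinarith [mul_le_mul_of_nonneg_left hH.1 hη0.le, mul_le_mul_of_nonneg_left hU.2 hη0.le,
      mul_le_mul_of_nonneg_left hW.1 hη0.le]
  -- The sign of `1 - η` decides which triangle inequality is used: `u ≥ |h - w|` if `η ≤ 1`, and `u
  -- ≤ h + w` if `η ≥ 1`.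
  have hexact : η * w ^ 2 - (h ^ 2 - u ^ 2) * (1 - η) ≥ w ^ 2 - θ * (h * w) := by
    rcases le_total η 1 with h1 | h1
    · have : (h - w) ^ 2 ≤ u ^ 2 :=
        sq_le_sq' (by linarith) (by linarith)
      linarith [mul_le_mul_of_nonneg_right this (sub_nonneg.2 h1),
        mul_le_mul_of_nonneg_right hη.2 hhw]
    · linarith [mul_le_mul_of_nonneg_right hu2 (sub_nonneg.2 h1),
        mul_le_mul_of_nonneg_right hη.1 hhw]
  have hθhw : θ * (h * w) ≤ w ^ 2 / 2 + θ ^ 2 * h ^ 2 / 2 := by linarith [sq_nonneg (w - θ * h)]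
  have hmain : (1 - 9 * ε) * w ^ 2 ≤ (θ ^ 2 + 9 * ε) * h ^ 2 + 9 * ρ := by linarith
  have hh2 : (1 - ε) * h ^ 2 ≤ AH + ρ := by linarith
  have hAW : AW ≤ (1 + ε) * w ^ 2 + ρ := by linarith
  have hερ : 60 * (ε * ρ) ≤ ρ := by linarith [mul_le_mul_of_nonneg_right hε1 hρ]
  have hερ0 : 0 ≤ ε * ρ := by positivity
  have k1 : (1 - ε) * (1 - 9 * ε) * AW ≤
      (1 + ε) * (θ ^ 2 + 9 * ε) * (AH + ρ) + (1 + ε) * (9 * ρ) + ρ := by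
    have e1 : (1 - 9 * ε) * AW ≤ (1 + ε) * ((θ ^ 2 + 9 * ε) * h ^ 2 + 9 * ρ) + (1 - 9 * ε) * ρ := by
      linarith [mul_le_mul_of_nonneg_left hAW (show 0 ≤ 1 - 9 * ε by linarith),
        mul_le_mul_of_nonneg_left hmain (show 0 ≤ 1 + ε by linarith)]
    have e2 := mul_le_mul_of_nonneg_left e1 (show 0 ≤ 1 - ε by linarith)
    have e3 := mul_le_mul_of_nonneg_left hh2
      (show 0 ≤ (1 + ε) * (θ ^ 2 + 9 * ε) by positivity)
    linarith
  obtain ⟨D, hD⟩ : ∃ D, D = (1 - ε) * (1 - 9 * ε) := ⟨_, rfl⟩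
  rw [← hD] at k1
  have hD1 : 1 - 10 * ε ≤ D := by linarith [sq_nonneg ε]
  have hθ1 : θ ^ 2 ≤ 1 := by linarith
  have hD2 : (1 + ε) * (θ ^ 2 + 9 * ε) ≤ (1 + θ ^ 2) / 2 * D := by
    have hα : (1 + θ ^ 2) / 2 * (1 - 10 * ε) ≤ (1 + θ ^ 2) / 2 * D :=
      mul_le_mul_of_nonneg_left hD1 (by positivity)
    linarith [mul_le_mul_of_nonneg_left hθ1 hε.le, mul_le_mul_of_nonneg_left hε1 hε.le]
  have k2 : D * AW ≤ D * ((1 + θ ^ 2) / 2 * AH + 16 * ρ) := by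
    have f1 := mul_le_mul_of_nonneg_right hD2 (add_nonneg hAH hρ)
    have f2 : (1 + θ ^ 2) / 2 * (D * ρ) ≤ 1 * (D * ρ) :=
      mul_le_mul_of_nonneg_right (by linarith) (mul_nonneg (by linarith) hρ)
    have f3 := mul_le_mul_of_nonneg_right hD1 hρ
    linarith
  exact le_of_mul_le_mul_left k2 (by linarith)

variable {m n : ℕ}

theorem Matrix.inner_toEuclideanLin_transpose (A : Matrix (Fin m) (Fin n) ℝ)
    (y : EuclideanSpace ℝ (Fin m)) (x : EuclideanSpace ℝ (Fin n)) :
    inner ℝ (A.transpose.toEuclideanLin y) x = inner ℝ y (A.toEuclideanLin x) := by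
  rw [← Matrix.conjTranspose_eq_transpose_of_trivial,
    Matrix.toEuclideanLin_conjTranspose_eq_adjoint, LinearMap.adjoint_inner_left]

theorem pgdLoss_apply_self (A : Matrix (Fin m) (Fin n) ℝ) (xs x : EuclideanSpace ℝ (Fin n)) :
    pgdLoss A (A.toEuclideanLin xs) x = ‖A.toEuclideanLin (x - xs)‖ ^ 2 := by
  rw [pgdLoss, ← map_sub, ← neg_sub x xs, map_neg, norm_neg]

/-- Expand both squares in `h`: the gradient term `‖η g‖²` cancels, and polarization rewrites the
remaining inner product through `‖A (x' - xs)‖²`. -/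
theorem pgdStep_ineq (A : Matrix (Fin m) (Fin n) ℝ) (η : ℝ) (xs x x' : EuclideanSpace ℝ (Fin n))
    (h : ‖pgdStep A (A.toEuclideanLin xs) η x - x'‖ ≤ ‖pgdStep A (A.toEuclideanLin xs) η x - xs‖) :
    ‖x' - x‖ ^ 2 + η * ‖A.toEuclideanLin (x' - xs)‖ ^ 2 ≤
      ‖x - xs‖ ^ 2 - η * ‖A.toEuclideanLin (x - xs)‖ ^ 2
        + η * ‖A.toEuclideanLin (x' - x)‖ ^ 2 := by
  set L := A.toEuclideanLin
  set g := A.transpose.toEuclideanLin (L xs - L x)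
  have e1 : pgdStep A (L xs) η x - x' = η • g - (x' - x) := by simp [pgdStep, g, L]; abel
  have e2 : pgdStep A (L xs) η x - xs = η • g - (xs - x) := by simp [pgdStep, g, L]; abel
  have h2 := pow_le_pow_left₀ (norm_nonneg _) h 2
  rw [e1, e2, norm_sub_sq_real (η • g) (x' - x), norm_sub_sq_real (η • g) (xs - x), inner_smul_left, inner_smul_left,
    Matrix.inner_toEuclideanLin_transpose, Matrix.inner_toEuclideanLin_transpose] at h2
  change _ - 2 * (_ * inner ℝ (L xs - L x) (L (x' - x))) + _ ≤
    _ - 2 * (_ * inner ℝ (L xs - L x) (L (xs - x))) + _ at h2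
  rw [← map_sub, real_inner_self_eq_norm_sq] at h2
  have e3 : L (x' - xs) = L (x' - x) - L (xs - x) := by rw [← map_sub]; congr 1; abel
  have e4 := norm_sub_sq_real (L (x' - x)) (L (xs - x))
  rw [e3, e4, real_inner_comm, norm_sub_rev x xs, ← neg_sub xs x, map_neg, norm_neg]
  simp only [conj_trivial] at h2
  nlinarith

/-- The conclusion of the convergence theorem for one measurement matrix. -/
theorem pgd_convergence {k : ℕ} {A : Matrix (Fin m) (Fin n) ℝ}
    {G : EuclideanSpace ℝ (Fin k) → EuclideanSpace ℝ (Fin n)} {Z : Set (EuclideanSpace ℝ (Fin k))}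
    {γ δ θ ε : ℝ} (hδ : 0 ≤ δ) (hθ : θ < 1) (hε : 0 < ε)
    (hεθ : 60 * ε ≤ 1 - θ ^ 2) (hεγ : ε ≤ 1 - γ)
    (hA : ∀ p ∈ insert 0 (G '' Z), ∀ q ∈ insert 0 (G '' Z),
      |‖A.toEuclideanLin (p - q)‖ ^ 2 - ‖p - q‖ ^ 2| ≤ ε * ‖p - q‖ ^ 2 + δ / 16) :
    SREC (G '' Z) A γ δ ∧ ∀ xs ∈ G '' Z, ∀ η : ℝ, |1 - η| ≤ θ / 2 →
      ∀ x : ℕ → EuclideanSpace ℝ (Fin n), IsPGD A (A.toEuclideanLin xs) G Z η x →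
      (∀ t, pgdLoss A (A.toEuclideanLin xs) (x (t + 1)) ≤
        (1 + θ ^ 2) / 2 * pgdLoss A (A.toEuclideanLin xs) (x t) + δ) ∧
      (∀ t, pgdLoss A (A.toEuclideanLin xs) (x t) ≤
        ((1 + θ ^ 2) / 2) ^ t * pgdLoss A (A.toEuclideanLin xs) (x 0)
          + δ / (1 - (1 + θ ^ 2) / 2)) ∧
      (∀ t, 1 ≤ t → γ * ‖x t - xs‖ ^ 2 ≤
        ((1 + θ ^ 2) / 2) ^ t * pgdLoss A (A.toEuclideanLin xs) (x 0)
          + δ / (1 - (1 + θ ^ 2) / 2) + δ) := by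
  have hrec : SREC (G '' Z) A γ δ := by
    intro p hp q hq
    have h := (abs_le.1 (hA p (Set.mem_insert_of_mem _ hp) q (Set.mem_insert_of_mem _ hq))).1
    nlinarith [mul_le_mul_of_nonneg_right hεγ (sq_nonneg ‖p - q‖)]
  refine ⟨hrec, ?_⟩
  rintro _ ⟨zs, hzs, rfl⟩ η hη x ⟨hx0, hx⟩
  set α := (1 + θ ^ 2) / 2 with hα
  have hα0 : 0 ≤ α := by positivity
  have hα1 : 0 < 1 - α := by rw [hα]; linarith
  have hsucc : ∀ t, x (t + 1) ∈ G '' Z := fun t => by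
    obtain ⟨z, hz, -, h⟩ := hx t
    exact ⟨z, hz, h.symm⟩
  have hmem : ∀ t, x t ∈ insert 0 (G '' Z) := fun t => by
    cases t with
    | zero => exact Or.inl hx0
    | succ t => exact Or.inr (hsucc t)
  have hxs : G zs ∈ insert 0 (G '' Z) := Or.inr ⟨zs, hzs, rfl⟩
  have hstep : ∀ t, pgdLoss A (A.toEuclideanLin (G zs)) (x (t + 1)) ≤
      α * pgdLoss A (A.toEuclideanLin (G zs)) (x t) + δ := by
    intro t
    obtain ⟨z, hz, hmin, hxz⟩ := hx t
    have hle := hmin hzs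
    simp only [Set.mem_ofPred_eq, ← hxz] at hle
    have := pgd_contraction (norm_nonneg (x t - G zs)) (norm_nonneg (x (t + 1) - G zs))
      (u := ‖x (t + 1) - x t‖) (ρ := δ / 16) ?_ ?_ ?_ (norm_nonneg _) hη hθ hε hεθ (by positivity)
      (hA _ (hmem t) _ hxs) (hA _ (hmem (t + 1)) _ (hmem t)) (hA _ (hmem (t + 1)) _ hxs)
      (sq_nonneg _) (pgdStep_ineq A η _ _ _ hle)
    · rw [pgdLoss_apply_self, pgdLoss_apply_self, hα]
      linarith
    · have := norm_sub_le_norm_sub_add_norm_sub (x (t + 1)) (G zs) (x t)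
      rwa [norm_sub_rev (G zs)] at this
    · have := norm_sub_le_norm_sub_add_norm_sub (x t) (x (t + 1)) (G zs)
      rwa [norm_sub_rev (x t) (x (t + 1))] at this
    · exact norm_sub_le_norm_sub_add_norm_sub _ _ _
  -- `δ / (1 - α)` is the fixed point of `r ↦ α r + δ`.
  have hgeom : ∀ t, pgdLoss A (A.toEuclideanLin (G zs)) (x t) ≤
      α ^ t * pgdLoss A (A.toEuclideanLin (G zs)) (x 0) + δ / (1 - α) := by
    intro t
    induction t with
    | zero =>
      rw [pow_zero, one_mul]
      exact le_add_of_nonneg_right (by positivity)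
    | succ t ih =>
      calc _ ≤ α * pgdLoss A (A.toEuclideanLin (G zs)) (x t) + δ := hstep t
        _ ≤ α * (α ^ t * pgdLoss A (A.toEuclideanLin (G zs)) (x 0) + δ / (1 - α)) + δ := by gcongr
        _ = _ := by field_simp; ring
  refine ⟨hstep, hgeom, fun t ht => ?_⟩
  -- S-REC is only available on the range, which `x 0 = 0` may miss; hence `t ≥ 1`.
  obtain ⟨t, rfl⟩ := Nat.exists_eq_add_of_le' ht
  have h1 := hrec _ (hsucc t) _ ⟨zs, hzs, rfl⟩
  have h2 := hgeom (t + 1)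
  rw [pgdLoss_apply_self] at h2
  linarith

end ProjectedGradient

/-! ### From the net to the whole range. -/

section UniformNearIsometry

theorem abs_norm_sq_sub_le_of_net {m n : ℕ} (hn : 0 < n) {A : Matrix (Fin m) (Fin n) ℝ}
    {S T : Set (EuclideanSpace ℝ (Fin n))} {ε τ : ℝ} (hε : 0 < ε) (hε1 : ε ≤ 1)
    (hST : ∀ p ∈ S, ∃ g ∈ T, ‖p - g‖ ≤ τ)
    (hT : ∀ p ∈ T, ∀ q ∈ T, |‖A.toEuclideanLin (p - q)‖ ^ 2 - ‖p - q‖ ^ 2| ≤ ε * ‖p - q‖ ^ 2)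
    (hA : ∑ p : Fin m × Fin n, A p.1 p.2 ^ 2 ≤ 2 * n) {p q : EuclideanSpace ℝ (Fin n)}
    (hp : p ∈ S) (hq : q ∈ S) :
    |‖A.toEuclideanLin (p - q)‖ ^ 2 - ‖p - q‖ ^ 2| ≤
      7 * ε * ‖p - q‖ ^ 2 + 64 * n * τ ^ 2 / ε := by
  obtain ⟨g, hg, hpg⟩ := hST p hp
  obtain ⟨g', hg', hqg⟩ := hST q hq
  have h := abs_norm_sq_sub_le_of_add A.toEuclideanLin hε hε1 (e := (p - g) - (q - g'))
    (hT g hg g' hg')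
  have e : g - g' + ((p - g) - (q - g')) = p - q := by abel
  rw [e] at h
  refine h.trans (add_le_add le_rfl ?_)
  set r := (p - g) - (q - g')
  have hr : ‖r‖ ^ 2 ≤ 4 * τ ^ 2 := by
    have h1 : ‖r‖ ≤ 2 * τ := (norm_sub_le _ _).trans (by linarith)
    have := pow_le_pow_left₀ (norm_nonneg _) h1 2
    linarith
  have hAr : ‖A.toEuclideanLin r‖ ^ 2 ≤ 2 * n * (4 * τ ^ 2) :=
    (A.norm_sq_toEuclideanLin_le r).trans (by gcongr)
  have hn1 : (1 : ℝ) ≤ n := by exact_mod_cast hn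
  calc 8 / ε * ‖r‖ ^ 2 + 4 / ε * ‖A.toEuclideanLin r‖ ^ 2
      ≤ 8 / ε * (1 * (4 * τ ^ 2)) + 4 / ε * (2 * n * (4 * τ ^ 2)) := by rw [one_mul]; gcongr
    _ ≤ 8 / ε * (n * (4 * τ ^ 2)) + 4 / ε * (2 * n * (4 * τ ^ 2)) := by gcongr
    _ = 64 * n * τ ^ 2 / ε := by ring

end UniformNearIsometry

/-! ### Size of the net against the number of measurements. -/

section Entropy

/-- The factor by which the logarithmic size of a net of the range of a network exceeds
`k d log n`. -/
noncomputable def entropyConstant (κ : ℝ) (B : ℕ) : ℝ :=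
  2 / Real.log 2 + 2 * Real.log (6 / κ) / Real.log 2 + 2 * (4 * B + 1)

theorem entropyConstant_pos {κ : ℝ} (hκ : 0 < κ) (hκ1 : κ ≤ 1) (B : ℕ) :
    0 < entropyConstant κ B := by
  have h2 := Real.log_pos one_lt_two
  have h1 : 0 ≤ Real.log (6 / κ) := Real.log_nonneg (by rw [le_div_iff₀ hκ]; linarith)
  unfold entropyConstant
  positivity

/-- The left side counts the failure events: two tails for each pair of net points, and the
Hilbert-Schmidt bound. -/
theorem two_mul_sq_add_one_le_exp_entropy {κ M : ℝ} (hκ : 0 < κ) (hκ1 : κ ≤ 1) {B d k n : ℕ}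
    (hd : 1 ≤ d) (hk : 1 ≤ k) (hn : 2 ≤ n) (hM0 : 0 ≤ M)
    (hM : M ≤ (6 / κ * n ^ (4 * (B * d) + 1)) ^ k) :
    2 * M ^ 2 + 1 ≤ Real.exp (entropyConstant κ B * (k * d * Real.log n)) := by
  have hn' : (2 : ℝ) ≤ n := by exact_mod_cast hn
  have hk' : (1 : ℝ) ≤ k := by exact_mod_cast hk
  have hd' : (1 : ℝ) ≤ d := by exact_mod_cast hd
  have hlog2 := Real.log_pos one_lt_two
  have hlogn : Real.log 2 ≤ Real.log n := Real.log_le_log two_pos hn'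
  have h6 : 1 ≤ 6 / κ := by rw [le_div_iff₀ hκ]; linarith
  have hκlog : 0 ≤ Real.log (6 / κ) := Real.log_nonneg h6
  have hbase : 1 ≤ 6 / κ * (n : ℝ) ^ (4 * (B * d) + 1) :=
    one_le_mul_of_one_le_of_one_le h6 (one_le_pow₀ (by linarith))
  set K := (6 / κ * (n : ℝ) ^ (4 * (B * d) + 1)) ^ k with hK
  have hK1 : 1 ≤ K := one_le_pow₀ hbase
  have hlogK : Real.log K = k * (Real.log (6 / κ) + (4 * (B * d) + 1) * Real.log n) := by
    rw [hK, Real.log_pow, Real.log_mul (by positivity) (by positivity), Real.log_pow]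
    push_cast
    ring
  have h3 : (3 : ℝ) ≤ Real.exp 2 := by linarith [Real.add_one_le_exp (2 : ℝ)]
  calc 2 * M ^ 2 + 1 ≤ 2 * K ^ 2 + K ^ 2 := by
        gcongr
        exact one_le_pow₀ hK1
    _ = 3 * K ^ 2 := by ring
    _ ≤ Real.exp 2 * Real.exp (Real.log K) ^ 2 := by
        rw [Real.exp_log (by linarith)]
        gcongr
    _ = Real.exp (2 + 2 * Real.log K) := by
        rw [← Real.exp_nat_mul, ← Real.exp_add]
        norm_num
    _ ≤ _ := by
        rw [Real.exp_le_exp, hlogK, entropyConstant]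
        have hkd : (k : ℝ) * Real.log 2 ≤ k * d * Real.log n :=
          mul_le_mul (le_mul_of_one_le_right (by linarith) hd') hlogn hlog2.le (by positivity)
        have h1 : 2 ≤ 2 / Real.log 2 * (k * d * Real.log n) := by
          rw [div_mul_eq_mul_div, le_div_iff₀ hlog2]
          linarith [mul_le_mul_of_nonneg_right hk' hlog2.le]
        have h2 : 2 * (k * Real.log (6 / κ)) ≤
            2 * Real.log (6 / κ) / Real.log 2 * (k * d * Real.log n) := by
          rw [div_mul_eq_mul_div, le_div_iff₀ hlog2]
          linarith [mul_le_mul_of_nonneg_left hkd hκlog]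
        have h3 : (k : ℝ) * Real.log n ≤ k * d * Real.log n := by
          gcongr
          exact le_mul_of_one_le_right (by linarith) hd'
        linarith

theorem Network.exists_net_range {κ δ : ℝ} (hκ : 0 < κ) (hκ1 : κ ≤ 1) {B d k n : ℕ}
    (hk : 1 ≤ k) (hn : 2 ≤ n) (N : Network d k n) (hN : N.BoundedBy ((n : ℝ) ^ B))
    (hδ : ((n : ℝ) ^ (B * d))⁻¹ ≤ δ) {Z : Set (EuclideanSpace ℝ (Fin k))}
    (hZ : ∀ z ∈ Z, ∃ z' : EuclideanSpace ℝ (Fin k), ‖z'‖ ≤ (n : ℝ) ^ (B * d) ∧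
      ‖N.toFun z - N.toFun z'‖ ≤ κ * √(δ / n)) :
    ∃ T : Finset (EuclideanSpace ℝ (Fin n)),
      (T.card : ℝ) ≤ (6 / κ * n ^ (4 * (B * d) + 1)) ^ k ∧
      ∀ p ∈ insert 0 (N.toFun '' Z), ∃ g ∈ T, ‖p - g‖ ≤ 2 * (κ * √(δ / n)) := by
  classical
  have hn' : (2 : ℝ) ≤ n := by exact_mod_cast hn
  have hn0 : (0 : ℝ) < n := by linarith
  have hn1 : (1 : ℝ) ≤ n := by linarith
  have hδ0 : 0 < δ := lt_of_lt_of_le (by positivity) hδ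
  set R := (n : ℝ) ^ (B * d) with hR
  have hR1 : 1 ≤ R := one_le_pow₀ hn1
  -- The lower bound on `δ` keeps the mesh polynomial in `R` and `n`, hence the net small.
  have hsqrt : (R * n)⁻¹ ≤ √(δ / n) := by
    refine Real.le_sqrt_of_sq_le ?_
    have h1 : (R * n)⁻¹ ≤ 1 := inv_le_one_of_one_le₀ (one_le_mul_of_one_le_of_one_le hR1 hn1)
    calc (R * n)⁻¹ ^ 2 ≤ (R * n)⁻¹ := pow_le_of_le_one (by positivity) h1 two_ne_zero
      _ = R⁻¹ / n := by rw [mul_inv, div_eq_mul_inv]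
      _ ≤ δ / n := by gcongr
  set τ := κ * √(δ / n) with hτ
  have hτ0 : 0 < τ := by positivity
  -- The network is `R²`-Lipschitz, so mesh `τ / R²` in latent space becomes `τ` in the range.
  obtain ⟨T, hTcard, hT⟩ := exists_finset_cover_closedBall
    (E := EuclideanSpace ℝ (Fin k)) (R := R) (s := τ / R ^ 2) (by positivity) (by positivity)
  rw [finrank_euclideanSpace_fin] at hTcard
  refine ⟨insert 0 (T.image N.toFun), ?_, ?_⟩
  · have hX : 1 + 2 * R / (τ / R ^ 2) ≤ 3 / κ * n ^ (4 * (B * d) + 1) := by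
      have h1 : (n : ℝ) ^ (4 * (B * d) + 1) = R ^ 4 * n := by rw [hR]; ring
      have h2 : 2 * R / (τ / R ^ 2) ≤ 2 / κ * (R ^ 4 * n) := by
        calc 2 * R / (τ / R ^ 2) = 2 * R ^ 3 / τ := by field_simp
          _ ≤ 2 * R ^ 3 / (κ * (R * n)⁻¹) := by
            gcongr
            exact mul_le_mul_of_nonneg_left hsqrt hκ.le
          _ = 2 / κ * (R ^ 4 * n) := by field_simp
      have h3 : 1 ≤ 1 / κ * (R ^ 4 * n) :=
        one_le_mul_of_one_le_of_one_le ((one_le_div hκ).2 hκ1)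
          (one_le_mul_of_one_le_of_one_le (one_le_pow₀ hR1) hn1)
      rw [h1]
      calc _ ≤ 1 / κ * (R ^ 4 * n) + 2 / κ * (R ^ 4 * n) := add_le_add h3 h2
        _ = _ := by ring
    have hpos : 0 ≤ 2 * R / (τ / R ^ 2) := by positivity
    calc ((insert 0 (T.image N.toFun)).card : ℝ) ≤ T.card + 1 := by
          exact_mod_cast (Finset.card_insert_le _ _).trans
            (Nat.add_le_add_right Finset.card_image_le 1)
      _ ≤ (1 + 2 * R / (τ / R ^ 2)) ^ k + (1 + 2 * R / (τ / R ^ 2)) ^ k :=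
          add_le_add hTcard (one_le_pow₀ (by linarith))
      _ = 2 * (1 + 2 * R / (τ / R ^ 2)) ^ k := by ring
      _ ≤ 2 ^ k * (3 / κ * n ^ (4 * (B * d) + 1)) ^ k := by
          gcongr
          exact le_self_pow₀ one_le_two (by omega)
      _ = _ := by rw [← mul_pow]; congr 1; ring
  · rintro _ (rfl | ⟨z, hz, rfl⟩)
    · exact ⟨0, by simp, by simpa using hτ0.le⟩
    · obtain ⟨z', hz', hzz'⟩ := hZ z hz
      obtain ⟨y, hy, hyz⟩ := hT z' hz'
      refine ⟨N.toFun y, Finset.mem_insert_of_mem (Finset.mem_image_of_mem _ hy), ?_⟩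
      have hL : ‖N.toFun z' - N.toFun y‖ ≤ τ := by
        refine (N.norm_toFun_sub_le (by positivity) hN z' y).trans ?_
        have h1 : ((n : ℝ) ^ B) ^ (2 * d) = R ^ 2 := by rw [hR]; ring
        rw [h1]
        calc R ^ 2 * ‖z' - y‖ ≤ R ^ 2 * (τ / R ^ 2) := by gcongr
          _ = τ := by field_simp
      linarith [norm_sub_le_norm_sub_add_norm_sub (N.toFun z) (N.toFun z') (N.toFun y)]

end Entropy

/-! ### Choice of constants and conclusion. -/

theorem theorem1 (γ : ℝ) (hγ : 2 / 3 < γ) (hγ' : γ < 1) :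
    ∃ (α : ℝ → ℝ) (c κ : ℝ), 0 < c ∧ 0 < κ ∧
      (∀ η : ℝ, 1 / (2 * γ) < η → η < 1 / γ → 0 < α η ∧ α η < 1) ∧
      ∀ B : ℕ, ∃ C : ℝ, 0 < C ∧
        ∀ (d k n m : ℕ), 1 ≤ d → 1 ≤ k → 2 ≤ n → C * (k * d * Real.log n) ≤ m →
        ∀ (N : Network d k n), N.BoundedBy ((n : ℝ) ^ B) → Differentiable ℝ N.toFun →
        ∀ (δ : ℝ), ((n : ℝ) ^ (B * d))⁻¹ ≤ δ →
        ∀ (Z : Set (EuclideanSpace ℝ (Fin k))),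
        (∀ z ∈ Z, ∃ z' : EuclideanSpace ℝ (Fin k), ‖z'‖ ≤ (n : ℝ) ^ (B * d) ∧
          ‖N.toFun z - N.toFun z'‖ ≤ κ * √(δ / n)) →
        ∀ (Ω : Type*) [MeasurableSpace Ω] (P : Measure Ω) [IsProbabilityMeasure P]
          (A : Ω → Matrix (Fin m) (Fin n) ℝ), IsGaussianMatrix P A →
        P {ω | ¬ (SREC (N.toFun '' Z) (A ω) γ δ ∧
          ∀ xs ∈ N.toFun '' Z, ∀ η : ℝ, 1 / (2 * γ) < η → η < 1 / γ →
          ∀ x : ℕ → EuclideanSpace ℝ (Fin n),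
          IsPGD (A ω) ((A ω).toEuclideanLin xs) N.toFun Z η x →
          (∀ t, pgdLoss (A ω) ((A ω).toEuclideanLin xs) (x (t + 1)) ≤
            α η * pgdLoss (A ω) ((A ω).toEuclideanLin xs) (x t) + δ) ∧
          (∀ t, pgdLoss (A ω) ((A ω).toEuclideanLin xs) (x t) ≤
            α η ^ t * pgdLoss (A ω) ((A ω).toEuclideanLin xs) (x 0) + δ / (1 - α η)) ∧
          (∀ t, 1 ≤ t → γ * ‖x t - xs‖ ^ 2 ≤
            α η ^ t * pgdLoss (A ω) ((A ω).toEuclideanLin xs) (x 0) + δ / (1 - α η) + δ))}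
          ≤ ENNReal.ofReal (Real.exp (-c * m)) := by
  have hγ0 : 0 < γ := by linarith
  obtain ⟨θ, hθ0, hθ1, hθ⟩ : ∃ θ : ℝ, 0 ≤ θ ∧ θ < 1 ∧
      ∀ η : ℝ, 1 / (2 * γ) < η → η < 1 / γ → |1 - η| ≤ θ / 2 := by
    have h1 : 1 < 1 / γ := (one_lt_div hγ0).2 hγ'
    have h2 : 1 / γ < 3 / 2 := by rw [div_lt_iff₀ hγ0]; linarith
    have h3 : 1 / (2 * γ) = 1 / γ / 2 := by field_simp
    -- These are the values of `2|1 - η|` at the two ends of the interval; the second is below `1`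
    -- exactly when `γ > 2/3`.
    refine ⟨max (2 - 1 / γ) (2 / γ - 2), le_max_of_le_left (by linarith),
      max_lt (by linarith) ?_, fun η hη hη' => ?_⟩
    · have : 2 / γ = 2 * (1 / γ) := by ring
      linarith
    · have : 2 / γ = 2 * (1 / γ) := by ring
      rw [h3] at hη
      have l1 := le_max_left (2 - 1 / γ) (2 / γ - 2)
      have l2 := le_max_right (2 - 1 / γ) (2 / γ - 2)
      rw [abs_le]
      constructor <;> linarith
  have hθ2 : 0 < 1 - θ ^ 2 := by
    have := pow_lt_one₀ hθ0 hθ1 two_ne_zero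
    linarith
  obtain ⟨ε, hε, hε1, hεθ, hεγ⟩ : ∃ ε : ℝ, 0 < ε ∧ ε < 1 ∧ 60 * (7 * ε) ≤ 1 - θ ^ 2 ∧
      7 * ε ≤ 1 - γ := by
    have h1 := min_le_left ((1 - θ ^ 2) / 420) ((1 - γ) / 7)
    have h2 := min_le_right ((1 - θ ^ 2) / 420) ((1 - γ) / 7)
    exact ⟨min ((1 - θ ^ 2) / 420) ((1 - γ) / 7), lt_min (by positivity) (by linarith),
      by linarith, by linarith, by linarith⟩
  -- With net error `2κ√(δ/n)`, the additive error is `64n · 4κ²(δ/n)/ε = 256κ²δ/ε = δ/16`.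
  obtain ⟨κ, hκ, hκ1, hκε⟩ : ∃ κ : ℝ, 0 < κ ∧ κ ≤ 1 ∧ κ ^ 2 = ε / 4096 := by
    refine ⟨√(ε / 4096), by positivity, Real.sqrt_le_one.2 (by linarith), Real.sq_sqrt (by linarith)⟩
  have hrate := concentrationRate_pos hε hε1
  refine ⟨fun _ => (1 + θ ^ 2) / 2, concentrationRate ε / 2, κ, by positivity, hκ,
    fun η _ _ => ⟨by positivity, by linarith⟩, fun B => ?_⟩
  have hent := entropyConstant_pos hκ hκ1 B
  -- Half of the concentration exponent pays for the union bound; the other half is `c`.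
  refine ⟨2 * entropyConstant κ B / concentrationRate ε, by positivity, ?_⟩
  intro d k n m hd hk hn hm N hN _ δ hδ Z hZ Ω _ P _ A hA
  have hn0 : 0 < n := by omega
  have hnR : (0 : ℝ) < n := by exact_mod_cast hn0
  have hδ0 : 0 < δ := lt_of_lt_of_le (by positivity) hδ
  have hm0 : 0 < m := by
    have h1 : (0 : ℝ) < k := by exact_mod_cast hk
    have h2 : (0 : ℝ) < d := by exact_mod_cast hd
    have h3 : 0 < Real.log n := Real.log_pos (by exact_mod_cast hn)
    have h4 : (0 : ℝ) < m := lt_of_lt_of_le (by positivity) hm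
    exact_mod_cast h4
  obtain ⟨T, hTcard, hT⟩ := N.exists_net_range hκ hκ1 hk hn hN hδ hZ
  refine (measure_mono fun ω hω => ?_).trans
    ((hA.measure_exists_not_near_isometry_le hm0 hn0 hε hε1 T).trans (ENNReal.ofReal_le_ofReal ?_))
  · by_contra hgood
    simp only [Set.mem_ofPred_eq, not_or, not_exists, not_and, not_lt] at hgood
    refine hω ?_
    have hiso : ∀ p ∈ insert 0 (N.toFun '' Z), ∀ q ∈ insert 0 (N.toFun '' Z),
        |‖(A ω).toEuclideanLin (p - q)‖ ^ 2 - ‖p - q‖ ^ 2| ≤ 7 * ε * ‖p - q‖ ^ 2 + δ / 16 := by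
      intro p hp q hq
      refine (abs_norm_sq_sub_le_of_net hn0 (T := T) hε hε1.le hT hgood.1 hgood.2 hp hq).trans_eq ?_
      rw [mul_pow, mul_pow, Real.sq_sqrt (by positivity), hκε]
      field_simp
      ring
    obtain ⟨h1, h2⟩ := pgd_convergence hδ0.le hθ1 (by positivity) hεθ hεγ hiso
    exact ⟨h1, fun xs hxs η hη hη' => h2 xs hxs η (hθ η hη hη')⟩
  · calc (2 * (T.card : ℝ) ^ 2 + 1) * Real.exp (-concentrationRate ε * m)
        ≤ Real.exp (entropyConstant κ B * (k * d * Real.log n)) *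
            Real.exp (-concentrationRate ε * m) := by
          gcongr
          exact two_mul_sq_add_one_le_exp_entropy hκ hκ1 hd hk hn (by positivity) hTcard
      _ ≤ Real.exp (-(concentrationRate ε / 2) * m) := by
          rw [← Real.exp_add, Real.exp_le_exp]
          rw [div_mul_eq_mul_div, div_le_iff₀ hrate] at hm
          linarith
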